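/- Let $\mathcal C$ be a regular category (finite limits, coequalizers of kernel pairs, regular epimorphisms stable under pullback) in which every split monomorphism has a pushout along every morphism with the same domain. For an object $Y$, let $\mathrm{Pt}_Y(\mathcal C)$ be the category of points over $Y$: its objects are triples $(X,f,i)$ with $f\colon X\to Y$, $i\colon Y\to X$ and $fi=1_Y$, and its morphisms $(X,f,i)\to(X',f',i')$ are the morphisms $h\colon X\to X'$ with $f'h=f$ and $hi=i'$. For $\beta\colon Y\to W$ let $\beta^*\colon \mathrm{Pt}_W(\mathcal C)\to\mathrm{Pt}_Y(\mathcal C)$ be the functor given by pullback along $\beta$, and let $\beta_!\colon \mathrm{Pt}_Y(\mathcal C)\to\mathrm{Pt}_W(\mathcal C)$ be its left adjoint, which sends $(X,f,i)$ to the pushout of $i$ along $\beta$ with the induced point structure over $W$. Then the following conditions are equivalent: 1. $\mathcal C$ is a Goursat category: $RSR=SRS$ (composition of relations) for all equivalence relations $R,S$ on the same object of $\mathcal C$; 1′. $RSR=SRS$ for all effective equivalence relations (kernel pairs) $R,S$ on the same object of $\mathcal C$; 2. for every regular epimorphism $\beta\colon Y\to W$ in $\mathcal C$, the functor $\beta_!\colon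 \mathrm{Pt}_Y(\mathcal C)\to\mathrm{Pt}_W(\mathcal C)$ preserves binary products; 3. for every point $(X,f,i)$ over an object $Y$, every point $(U,g,j)$ over an object $W$, and all regular epimorphisms $\alpha\colon X\to U$ and $\beta\colon Y\to W$ with $\beta f=g\alpha$ and $\alpha i=j\beta$, the Beck–Chevalley condition holds: there is a natural isomorphism $\alpha_! f^*\cong g^*\beta_!$ of functors $\mathrm{Pt}_Y(\mathcal C)\to\mathrm{Pt}_U(\mathcal C)$; 3′. for all data as in 3, the canonical comparison $\alpha_! f^*\to g^*\beta_!$ (the mate, under the adjunctions $\beta_!\dashv\beta^*$ and $\alpha_!\dashv\alpha^*$, of the canonical isomorphism $f^*\beta^*\cong\alpha^*g^*$) is an isomorphism. -/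

import Mathlib

open CategoryTheory CategoryTheory.Limits

universe v u

namespace GoursatPt

/-! ### Relations in a regular category -/

section Relations

variable {C : Type u} [Category.{v} C]

/-- A relation from `X` to `Y`: a subobject of the product `X ⨯ Y`. -/
abbrev Relation [HasFiniteLimits C] (X Y : C) := Subobject (X ⨯ Y)

namespace Relation

/-- The first projection of a relation. -/
noncomputable def fst [HasFiniteLimits C] {X Y : C} (R : Relation X Y) : (R : C) ⟶ X :=
  R.arrow ≫ prod.fst

/-- The second projection of a relation. -/
noncomputable def snd [HasFiniteLimits C] {X Y : C} (R : Relation X Y) : (R : C) ⟶ Y :=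
  R.arrow ≫ prod.snd

/-- The composite of a relation `R` from `X` to `Y` with a relation `S` from `Y` to `Z`: the
regular image of the pullback `R ×_Y S` in `X ⨯ Z`. In terms of elements, `(x, z)` belongs to it
when `x R y` and `y S z` for some `y`. -/
noncomputable def comp [Regular C] {X Y Z : C} (R : Relation X Y) (S : Relation Y Z) :
    Relation X Z :=
  imageSubobject
    (prod.lift (pullback.fst R.snd S.fst ≫ R.fst) (pullback.snd R.snd S.fst ≫ S.snd))

end Relation

variable (C)

/-- A regular category is a Goursat category when `R S R = S R S` for any two equivalence
relations `R`, `S` on the same object. -/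
def IsGoursat [Regular C] : Prop :=
  ∀ ⦃X : C⦄ (R S : Relation X X),
    IsEquivalenceRelation R.fst R.snd → IsEquivalenceRelation S.fst S.snd →
      (R.comp S).comp R = (S.comp R).comp S

/-- The variant of the Goursat property in which only effective equivalence relations (that is,
kernel pairs) are required to 3-permute. -/
def IsEffectivelyGoursat [Regular C] : Prop :=
  ∀ ⦃X : C⦄ (R S : Relation X X),
    IsEffectiveEquivalenceRelation R.fst R.snd → IsEffectiveEquivalenceRelation S.fst S.snd →
      (R.comp S).comp R = (S.comp R).comp S

end Relations

/-! ### Points -/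

/-- `C` has pushouts along split monomorphisms: a split monomorphism `i` and an arbitrary
morphism `b` with the same domain have a pushout. -/
class HasPushoutsAlongSplitMonos (C : Type u) [Category.{v} C] : Prop where
  hasPushout {A B D : C} (i : A ⟶ B) (b : A ⟶ D) [IsSplitMono i] : HasPushout i b

section Points

variable {C : Type u} [Category.{v} C]

/-- A point over `Y`: a split epimorphism `π : X ⟶ Y` together with a chosen splitting `σ`. -/
structure Pt (Y : C) where
  /-- the domain of the split epimorphism -/
  X : C
  /-- the split epimorphism -/
  π : X ⟶ Y
  /-- the splitting -/
  σ : Y ⟶ X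
  σ_π : σ ≫ π = 𝟙 Y

namespace Pt

attribute [simp] σ_π

attribute [local simp] pullback.lift_fst pullback.lift_snd pullback.lift_fst_assoc
  pullback.lift_snd_assoc pushout.inl_desc pushout.inr_desc pushout.inl_desc_assoc
  pushout.inr_desc_assoc

@[simp]
theorem σ_π_assoc {Y : C} (P : Pt Y) {Z : C} (h : Y ⟶ Z) : P.σ ≫ P.π ≫ h = h := by
  rw [← Category.assoc, P.σ_π, Category.id_comp]

/-- A morphism of points over `Y`: a morphism commuting with the projections to `Y` and with the
splittings. -/
@[ext]
structure Hom {Y : C} (P Q : Pt Y) where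
  /-- the underlying morphism of `C` -/
  hom : P.X ⟶ Q.X
  w_π : hom ≫ Q.π = P.π
  w_σ : P.σ ≫ hom = Q.σ

attribute [simp] Hom.w_π Hom.w_σ

/-- The category `Pt_Y(C)` of points over `Y`, the fibre over `Y` of the fibration of points. -/
instance category (Y : C) : Category (Pt Y) where
  Hom P Q := Hom P Q
  id P := ⟨𝟙 P.X, by simp, by simp⟩
  comp a b := ⟨a.hom ≫ b.hom, by simp, by rw [← Category.assoc, a.w_σ, b.w_σ]⟩

@[ext]
theorem hom_ext {Y : C} {P Q : Pt Y} {a b : P ⟶ Q} (h : a.hom = b.hom) : a = b :=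
  Hom.ext h

@[simp]
theorem id_hom {Y : C} (P : Pt Y) : Hom.hom (𝟙 P) = 𝟙 P.X := rfl

@[simp]
theorem comp_hom {Y : C} {P Q R : Pt Y} (a : P ⟶ Q) (b : Q ⟶ R) :
    (a ≫ b).hom = a.hom ≫ b.hom := rfl

@[simp]
theorem hom_π {Y : C} {P Q : Pt Y} (a : P ⟶ Q) : a.hom ≫ Q.π = P.π := Hom.w_π a

@[simp]
theorem hom_π_assoc {Y : C} {P Q : Pt Y} (a : P ⟶ Q) {Z : C} (h : Y ⟶ Z) :
    a.hom ≫ Q.π ≫ h = P.π ≫ h := by rw [← Category.assoc, hom_π]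

@[simp]
theorem σ_hom {Y : C} {P Q : Pt Y} (a : P ⟶ Q) : P.σ ≫ a.hom = Q.σ := Hom.w_σ a

@[simp]
theorem σ_hom_assoc {Y : C} {P Q : Pt Y} (a : P ⟶ Q) {Z : C} (h : Q.X ⟶ Z) :
    P.σ ≫ a.hom ≫ h = Q.σ ≫ h := by rw [← Category.assoc, σ_hom]

/-- The pullback of a point `Q` over `W` along `β : Y ⟶ W`. -/
noncomputable abbrev pullObj [HasPullbacks C] {Y W : C} (β : Y ⟶ W) (Q : Pt W) : Pt Y where
  X := pullback Q.π β
  π := pullback.snd Q.π β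
  σ := pullback.lift (β ≫ Q.σ) (𝟙 Y) (by simp)
  σ_π := by simp

/-- The change-of-base functor `β^* : Pt_W(C) ⥤ Pt_Y(C)` along `β : Y ⟶ W`: pullback along `β`. -/
noncomputable abbrev pull [HasPullbacks C] {Y W : C} (β : Y ⟶ W) : Pt W ⥤ Pt Y where
  obj Q := pullObj β Q
  map {P Q} a :=
    { hom := pullback.lift (f := Q.π) (g := β) (pullback.fst P.π β ≫ a.hom) (pullback.snd P.π β)
        (by simp [pullback.condition])
      w_π := by simp
      w_σ := by apply pullback.hom_ext <;> simp }
  map_id P := by apply hom_ext; apply pullback.hom_ext <;> simp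
  map_comp a b := by apply hom_ext; apply pullback.hom_ext <;> simp

section Push

variable [HasPushoutsAlongSplitMonos C]

instance isSplitMono_σ {Y : C} (P : Pt Y) : IsSplitMono P.σ := ⟨⟨⟨P.π, P.σ_π⟩⟩⟩

instance hasPushout_σ {Y W : C} (P : Pt Y) (β : Y ⟶ W) : HasPushout P.σ β :=
  HasPushoutsAlongSplitMonos.hasPushout P.σ β

/-- The point over `W` obtained from a point `P` over `Y` by pushing out the splitting of `P`
along `β : Y ⟶ W`. -/
noncomputable abbrev pushObj {Y W : C} (β : Y ⟶ W) (P : Pt Y) : Pt W where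
  X := pushout P.σ β
  π := pushout.desc (P.π ≫ β) (𝟙 W) (by simp)
  σ := pushout.inr P.σ β
  σ_π := by simp

/-- The functor `β_! : Pt_Y(C) ⥤ Pt_W(C)` along `β : Y ⟶ W`: pushout of the splitting along `β`. -/
noncomputable abbrev push {Y W : C} (β : Y ⟶ W) : Pt Y ⥤ Pt W where
  obj P := pushObj β P
  map {P Q} a :=
    { hom := pushout.desc (f := P.σ) (g := β) (a.hom ≫ pushout.inl Q.σ β) (pushout.inr Q.σ β)
        (by simp [pushout.condition])
      w_π := by apply pushout.hom_ext <;> simp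
      w_σ := by simp }
  map_id P := by apply hom_ext; apply pushout.hom_ext <;> simp
  map_comp a b := by apply hom_ext; apply pushout.hom_ext <;> simp

/-- `β_!` is left adjoint to `β^*`. -/
noncomputable def pushPullAdj [HasPullbacks C] {Y W : C} (β : Y ⟶ W) :
    push β ⊣ pull β :=
  Adjunction.mkOfHomEquiv
    { homEquiv := fun P Q =>
        { toFun := fun a =>
            { hom := pullback.lift (pushout.inl P.σ β ≫ a.hom) P.π (by
                have h := hom_π a
                dsimp at h
                simp [h])
              w_π := by simp
              w_σ := by
                have h := σ_hom a
                dsimp at h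
                apply pullback.hom_ext
                · simp [← h, pushout.condition_assoc]
                · simp }
          invFun := fun b =>
            { hom := pushout.desc (b.hom ≫ pullback.fst Q.π β) Q.σ (by
                have h := σ_hom b
                dsimp at h
                rw [← Category.assoc, h]
                simp)
              w_π := by
                have h := hom_π b
                dsimp at h
                apply pushout.hom_ext
                · simp [pullback.condition, reassoc_of% h]
                · simp
              w_σ := by simp }
          left_inv := fun a => by
            have h := σ_hom a
            dsimp at h
            apply hom_ext
            apply pushout.hom_ext <;> simp [h]
          right_inv := fun b => by
            have h := hom_π b
            dsimp at h
            apply hom_ext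
            apply pullback.hom_ext <;> simp [h] }
      homEquiv_naturality_left_symm := fun a b => by
        apply hom_ext
        apply pushout.hom_ext <;> simp
      homEquiv_naturality_right := fun a b => by
        apply hom_ext
        apply pullback.hom_ext <;> simp }

end Push

section BeckChevalley

variable [HasPullbacks C]

/-- For a commutative square `f ≫ β = α ≫ g`, the canonical comparison
`f^* β^* ⟶ α^* g^*` between iterated pullbacks, where both sides are pullbacks along the
common composite. On the underlying objects it sends `((v, y), x)` to `((v, α x), x)`. -/
noncomputable def pullSquare {X Y U W : C} (f : X ⟶ Y) (β : Y ⟶ W) (α : X ⟶ U) (g : U ⟶ W)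
    (w : f ≫ β = α ≫ g) : pull β ⋙ pull f ⟶ pull g ⋙ pull α where
  app V :=
    { hom := pullback.lift
        (pullback.lift (pullback.fst (pullback.snd V.π β) f ≫ pullback.fst V.π β)
          (pullback.snd (pullback.snd V.π β) f ≫ α)
          (by
            rw [Category.assoc, pullback.condition, Category.assoc, ← w,
              pullback.condition_assoc]))
        (pullback.snd (pullback.snd V.π β) f) (by simp)
      w_π := by simp
      w_σ := by
        apply pullback.hom_ext
        · apply pullback.hom_ext
          · simp [reassoc_of% w]
          · simp
        · simp }
  naturality V V' a := by
    apply hom_ext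
    apply pullback.hom_ext
    · apply pullback.hom_ext <;> simp
    · simp

/-- The canonical Beck–Chevalley comparison `α_! f^* ⟶ g^* β_!` of a commutative square
`f ≫ β = α ≫ g`: the mate of the comparison `f^* β^* ⟶ α^* g^*` under the adjunctions
`β_! ⊣ β^*` and `α_! ⊣ α^*`. -/
noncomputable def beckChevalley [HasPushoutsAlongSplitMonos C] {X Y U W : C} (f : X ⟶ Y)
    (β : Y ⟶ W) (α : X ⟶ U) (g : U ⟶ W) (w : f ≫ β = α ≫ g) :
    pull f ⋙ push α ⟶ push β ⋙ pull g :=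
  ((mateEquiv (pushPullAdj β) (pushPullAdj α)).symm
    (TwoSquare.mk _ _ _ _ (pullSquare f β α g w))).natTrans

end BeckChevalley

end Pt

end Points

end GoursatPt

/-!
# Goursat categories, points and the Beck–Chevalley condition

Relations are handled through generalized elements: a pair belongs to a regular image or to a
composite of relations when witnesses exist after passing to a regular epimorphism
(`Relation.mem_comp_comp_iff`). Each condition is compared with the following one, for regular
epimorphisms of points `(α, β) : P ⟶ Q`: the induced morphism `P ×_Y P ⟶ Q ×_W Q` between the
kernel pairs of the projections is a regular epimorphism.

* This implies the Goursat property (`isGoursat_of_isRegularEpi`). For equivalence relations `R`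
  and `S`, the relation `S R S` is the direct image along the second projection of `S` of the
  inverse image of `R` along the first. Regarding both relations as points, transitivity of the
  inverse image passes to the direct image; hence `S R S` is an equivalence relation containing
  `R` and `S`, so it contains `R S R`.
* It follows from preservation of products and from the canonical Beck–Chevalley isomorphism, since
  they identify `β_! P ×_W β_! P` with `β_! (P ×_Y P)`, respectively `β_! P ×_W Q` with the
  pushforward of `P ×_Y P` along `α`, and a pushforward along a regular epimorphism is a regular
  quotient.
* Conversely, let the kernel pairs permute in the sense `R S R = S R S`. Then regular epimorphisms
  of points induce regular epimorphisms between fibre products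
  (`IsEffectivelyGoursat.isRegularEpi_pullbackMap`), and the Shifting Lemma holds
  (`IsEffectivelyGoursat.shifting`). Two applications of the latter show that
  `V ×_Y P ⟶ β_! V ×_W Q` is the pushout of `α` along the section of `V ×_Y P ⟶ P`
  (`IsEffectivelyGoursat.isPushout_pullbackMap`). This is the canonical Beck–Chevalley condition;
  pasting it with the pushout that defines `β_! P` gives preservation of products.
* An arbitrary isomorphism `φ : α_! f^* ≅ g^* β_!` also suffices
  (`isIso_beckChevalley_of_nonempty_iso`). The case where `β` and `g` are identities gives
  `f_! f^* ≅ 1`, so `f^*` is full for every split epimorphism `f`. By fullness, `φ` at `V` is the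
  canonical comparison followed by `g^* t`, for an endomorphism `t` of `β_! V`. Pulling back along
  the splitting of `g` shows that `t` is invertible.
-/

namespace GoursatPt

attribute [local simp] prod.lift_fst prod.lift_snd prod.lift_fst_assoc prod.lift_snd_assoc
  pullback.lift_fst pullback.lift_snd pullback.lift_fst_assoc pullback.lift_snd_assoc

/-! ### Regular epimorphisms in a regular category -/

section RegularEpi

variable {C : Type u} [Category.{v} C] [Regular C]

theorem isRegularEpi_of_strongEpi {X Y : C} (f : X ⟶ Y) [StrongEpi f] : IsRegularEpi f :=
  inferInstance

theorem isRegularEpi_comp {X Y Z : C} (f : X ⟶ Y) (g : Y ⟶ Z) [IsRegularEpi f] [IsRegularEpi g] :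
    IsRegularEpi (f ≫ g) :=
  isRegularEpi_of_strongEpi _

theorem isRegularEpi_of_comp {X Y Z : C} (f : X ⟶ Y) (g : Y ⟶ Z) [IsRegularEpi (f ≫ g)] :
    IsRegularEpi g :=
  have := strongEpi_of_strongEpi f g
  isRegularEpi_of_strongEpi g

/-- A generalized element of the codomain of a regular epimorphism lifts to the domain after
passing to a cover of its stage of definition. -/
theorem exists_lift_of_isRegularEpi {X Y T : C} (f : X ⟶ Y) [IsRegularEpi f] (y : T ⟶ Y) :
    ∃ (T' : C) (e : T' ⟶ T) (_ : IsRegularEpi e) (x : T' ⟶ X), x ≫ f = e ≫ y :=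
  ⟨_, pullback.snd f y, inferInstance, pullback.fst f y, pullback.condition⟩

/-- Two generalized elements lift along two regular epimorphisms over a common cover. -/
theorem exists_lift₂_of_isRegularEpi {X X' Y Y' T : C} (f : X ⟶ Y) (f' : X' ⟶ Y') [IsRegularEpi f]
    [IsRegularEpi f'] (y : T ⟶ Y) (y' : T ⟶ Y') :
    ∃ (T' : C) (e : T' ⟶ T) (_ : IsRegularEpi e) (x : T' ⟶ X) (x' : T' ⟶ X'),
      x ≫ f = e ≫ y ∧ x' ≫ f' = e ≫ y' := by
  obtain ⟨T₁, e₁, _, x, hx⟩ := exists_lift_of_isRegularEpi f y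
  obtain ⟨T₂, e₂, _, x', hx'⟩ := exists_lift_of_isRegularEpi f' (e₁ ≫ y')
  exact ⟨T₂, e₂ ≫ e₁, isRegularEpi_comp _ _, e₂ ≫ x, x', by simp [hx], by simp [hx']⟩

/-- A morphism onto which every generalized element lifts locally is a regular epimorphism. -/
theorem isRegularEpi_of_exists_lift {X Y : C} (f : X ⟶ Y)
    (h : ∀ ⦃T : C⦄ (y : T ⟶ Y), ∃ (T' : C) (e : T' ⟶ T) (_ : IsRegularEpi e) (x : T' ⟶ X),
      x ≫ f = e ≫ y) : IsRegularEpi f := by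
  obtain ⟨T', e, _, x, hx⟩ := h (𝟙 Y)
  rw [Category.comp_id] at hx
  have : IsRegularEpi (x ≫ f) := by rwa [hx]
  exact isRegularEpi_of_comp x f

/-- The pushout of a regular epimorphism along any morphism is a regular epimorphism. -/
theorem isRegularEpi_inl_of_isPushout {A B D E : C} {i : A ⟶ B} {b : A ⟶ D} {l : B ⟶ E} {r : D ⟶ E}
    (h : IsPushout i b l r) [IsRegularEpi b] : IsRegularEpi l := by
  have : ExtremalEpi l := .mk_of_hasEqualizers l fun Z p m fac _ => by
    have sq : CommSq (i ≫ p) b m r := ⟨by rw [Category.assoc, fac, h.w]⟩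
    let d : E ⟶ Z := h.desc p sq.lift (by simp)
    have hd : d ≫ m = 𝟙 E := by apply h.hom_ext <;> simp [d, fac]
    exact ⟨d, by rw [← cancel_mono m, Category.assoc, hd]; simp, hd⟩
  infer_instance

end RegularEpi

/-! ### Relations by generalized elements -/

namespace Relation

variable {C : Type u} [Category.{v} C]

section

variable [HasFiniteLimits C] {X Y : C}

/-- The generalized elements `x`, `y` of stage `T` are related by `R`: the pair `(x, y)` factors
through the subobject `R`. -/
def Mem (R : Relation X Y) {T : C} (x : T ⟶ X) (y : T ⟶ Y) : Prop :=
  R.Factors (prod.lift x y)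

theorem mem_iff (R : Relation X Y) {T : C} (x : T ⟶ X) (y : T ⟶ Y) :
    R.Mem x y ↔ ∃ t : T ⟶ (R : C), t ≫ R.fst = x ∧ t ≫ R.snd = y := by
  constructor
  · intro h
    replace h : R.Factors (prod.lift x y) := h
    exact ⟨R.factorThru _ h, by simp [fst], by simp [snd]⟩
  · rintro ⟨t, rfl, rfl⟩
    have : prod.lift (t ≫ R.fst) (t ≫ R.snd) = t ≫ R.arrow := by
      ext <;> simp [fst, snd]
    rw [Mem, this]
    exact Subobject.factors_comp_arrow t

theorem mem_fst_snd (R : Relation X Y) : R.Mem R.fst R.snd :=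
  (R.mem_iff _ _).2 ⟨𝟙 _, by simp, by simp⟩

theorem Mem.precomp {R : Relation X Y} {T T' : C} {x : T ⟶ X} {y : T ⟶ Y} (h : R.Mem x y)
    (e : T' ⟶ T) : R.Mem (e ≫ x) (e ≫ y) := by
  obtain ⟨t, rfl, rfl⟩ := (R.mem_iff _ _).1 h
  exact (R.mem_iff _ _).2 ⟨e ≫ t, by simp, by simp⟩

theorem le_of_mem {R S : Relation X Y}
    (h : ∀ ⦃T : C⦄ (x : T ⟶ X) (y : T ⟶ Y), R.Mem x y → S.Mem x y) : R ≤ S := by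
  apply Subobject.le_of_factors
  have := h _ _ R.mem_fst_snd
  rwa [Mem, show prod.lift R.fst R.snd = R.arrow by ext <;> simp [fst, snd]] at this

theorem hom_ext (R : Relation X Y) {T : C} {s t : T ⟶ (R : C)} (h₁ : s ≫ R.fst = t ≫ R.fst)
    (h₂ : s ≫ R.snd = t ≫ R.snd) : s = t := by
  rw [← cancel_mono R.arrow]
  ext
  · simpa [fst] using h₁
  · simpa [snd] using h₂

section Equivalence

variable {R : Relation X X} (hR : IsEquivalenceRelation R.fst R.snd)
include hR

theorem mem_refl {T : C} (x : T ⟶ X) : R.Mem x x := by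
  obtain ⟨⟨h⟩⟩ := hR
  exact (R.mem_iff _ _).2 ⟨x ≫ h.r, by simp, by simp⟩

theorem mem_symm {T : C} {x y : T ⟶ X} (hxy : R.Mem x y) : R.Mem y x := by
  obtain ⟨⟨h⟩⟩ := hR
  obtain ⟨t, rfl, rfl⟩ := (R.mem_iff _ _).1 hxy
  exact (R.mem_iff _ _).2 ⟨t ≫ h.s,
    by rw [Category.assoc, h.toSymmetricRelation.symmetry₁],
    by rw [Category.assoc, h.toSymmetricRelation.symmetry₂]⟩

theorem mem_trans {T : C} {x y z : T ⟶ X} (hxy : R.Mem x y) (hyz : R.Mem y z) : R.Mem x z := by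
  obtain ⟨⟨h⟩⟩ := hR
  obtain ⟨s, rfl, hs⟩ := (R.mem_iff _ _).1 hxy
  obtain ⟨t, ht, rfl⟩ := (R.mem_iff _ _).1 hyz
  refine (R.mem_iff _ _).2 ⟨PullbackCone.IsLimit.lift h.isLimit s t (hs.trans ht.symm) ≫ h.t, ?_, ?_⟩
  · rw [Category.assoc, h.toTransitiveRelation.transitivity₁]
    exact PullbackCone.IsLimit.lift_fst_assoc h.isLimit s t _ _
  · rw [Category.assoc, h.toTransitiveRelation.transitivity₂]
    exact PullbackCone.IsLimit.lift_snd_assoc h.isLimit s t _ _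

end Equivalence

end

section Regular

variable [Regular C] {X Y Z : C}

theorem Mem.of_cover {R : Relation X Y} {T T' : C} {x : T ⟶ X} {y : T ⟶ Y} (e : T' ⟶ T)
    [IsRegularEpi e] (h : R.Mem (e ≫ x) (e ≫ y)) : R.Mem x y := by
  replace h : R.Factors (prod.lift (e ≫ x) (e ≫ y)) := h
  have sq : CommSq (R.factorThru _ h) e R.arrow (prod.lift x y) :=
    ⟨by rw [Subobject.factorThru_arrow]; ext <;> simp⟩
  exact (Subobject.factors_iff _ _).2 ⟨sq.lift, sq.fac_right⟩

/-- The regular image consists of the pairs that are locally in the range. -/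
theorem mem_imageSubobject_iff {A T : C} (p : A ⟶ X) (q : A ⟶ Y) (x : T ⟶ X) (y : T ⟶ Y) :
    Mem (imageSubobject (prod.lift p q)) x y ↔
      ∃ (T' : C) (e : T' ⟶ T) (_ : IsRegularEpi e) (a : T' ⟶ A),
        a ≫ p = e ≫ x ∧ a ≫ q = e ≫ y := by
  constructor
  · intro h
    replace h : (imageSubobject (prod.lift p q)).Factors (prod.lift x y) := h
    have : StrongEpi (factorThruImageSubobject (prod.lift p q)) := by
      unfold factorThruImageSubobject
      exact strongEpi_comp _ _
    obtain ⟨T', e, he, a, ha⟩ := exists_lift_of_isRegularEpi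
      (factorThruImageSubobject (prod.lift p q)) (Subobject.factorThru _ _ h)
    have ha' : a ≫ prod.lift p q = e ≫ prod.lift x y := by
      have := congr($ha ≫ (imageSubobject (prod.lift p q)).arrow)
      simpa only [Category.assoc, imageSubobject_arrow_comp, Subobject.factorThru_arrow] using this
    refine ⟨T', e, he, a, ?_, ?_⟩
    · simpa using congr($ha' ≫ prod.fst)
    · simpa using congr($ha' ≫ prod.snd)
  · rintro ⟨T', e, he, a, h₁, h₂⟩
    apply Mem.of_cover e
    rw [← h₁, ← h₂, Mem, show prod.lift (a ≫ p) (a ≫ q) = a ≫ prod.lift p q by ext <;> simp]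
    exact imageSubobject_factors_comp_self _ _

theorem mem_comp_iff (R : Relation X Y) (S : Relation Y Z) {T : C} (x : T ⟶ X) (z : T ⟶ Z) :
    (R.comp S).Mem x z ↔ ∃ (T' : C) (e : T' ⟶ T) (_ : IsRegularEpi e) (y : T' ⟶ Y),
      R.Mem (e ≫ x) y ∧ S.Mem y (e ≫ z) := by
  rw [comp, mem_imageSubobject_iff]
  constructor
  · rintro ⟨T', e, he, a, h₁, h₂⟩
    refine ⟨T', e, he, a ≫ pullback.fst _ _ ≫ R.snd, ?_, ?_⟩
    · exact (R.mem_iff _ _).2 ⟨a ≫ pullback.fst _ _, by simpa using h₁, by simp⟩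
    · exact (S.mem_iff _ _).2 ⟨a ≫ pullback.snd _ _, by simp [pullback.condition], by simpa using h₂⟩
  · rintro ⟨T', e, he, y, h₁, h₂⟩
    obtain ⟨r, hr, hr'⟩ := (R.mem_iff _ _).1 h₁
    obtain ⟨s, hs, hs'⟩ := (S.mem_iff _ _).1 h₂
    exact ⟨T', e, he, pullback.lift r s (hr'.trans hs.symm), by simp [hr], by simp [hs']⟩

/-- Membership in a threefold composite, witnessed over a single cover. -/
theorem mem_comp_comp_iff {W : C} (R : Relation X Y) (S : Relation Y Z) (R' : Relation Z W) {T : C}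
    (x : T ⟶ X) (w : T ⟶ W) :
    ((R.comp S).comp R').Mem x w ↔ ∃ (T' : C) (e : T' ⟶ T) (_ : IsRegularEpi e) (y : T' ⟶ Y)
      (z : T' ⟶ Z), R.Mem (e ≫ x) y ∧ S.Mem y z ∧ R'.Mem z (e ≫ w) := by
  rw [mem_comp_iff]
  constructor
  · rintro ⟨T₁, e₁, _, z, h, hz⟩
    obtain ⟨T₂, e₂, _, y, h₁, h₂⟩ := (mem_comp_iff _ _ _ _).1 h
    refine ⟨T₂, e₂ ≫ e₁, isRegularEpi_comp _ _, y, e₂ ≫ z, by simpa using h₁, h₂, ?_⟩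
    simpa using hz.precomp e₂
  · rintro ⟨T', e, he, y, z, h₁, h₂, h₃⟩
    refine ⟨T', e, he, z, (mem_comp_iff _ _ _ _).2 ⟨T', 𝟙 _, inferInstance, y, ?_, ?_⟩, h₃⟩
    · simpa using h₁
    · simpa using h₂

end Regular

end Relation

/-! ### Kernel pairs as relations -/

section Kernel

variable {C : Type u} [Category.{v} C]

/-- The kernel pair of a morphism, as a relation on its domain. -/
noncomputable def kernelRel [HasFiniteLimits C] {X A : C} (f : X ⟶ A) : Relation X X :=
  have : Mono (prod.lift (pullback.fst f f) (pullback.snd f f)) := ⟨fun s t h => by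
    apply pullback.hom_ext
    · simpa using congr($h ≫ prod.fst)
    · simpa using congr($h ≫ prod.snd)⟩
  Subobject.mk (prod.lift (pullback.fst f f) (pullback.snd f f))

theorem mem_kernelRel [HasFiniteLimits C] {X A T : C} (f : X ⟶ A) (x y : T ⟶ X) :
    (kernelRel f).Mem x y ↔ x ≫ f = y ≫ f := by
  rw [Relation.Mem, kernelRel, Subobject.mk_factors_iff]
  constructor
  · intro h
    obtain ⟨t, ht⟩ : ∃ t : T ⟶ pullback f f,
      t ≫ prod.lift (pullback.fst f f) (pullback.snd f f) = prod.lift x y := h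
    have h₁ : t ≫ pullback.fst f f = x := by simpa using congr($ht ≫ prod.fst)
    have h₂ : t ≫ pullback.snd f f = y := by simpa using congr($ht ≫ prod.snd)
    rw [← h₁, ← h₂, Category.assoc, pullback.condition, Category.assoc]
  · intro h
    exact ⟨pullback.lift x y h, by ext <;> simp⟩

theorem isKernelPair_kernelRel [HasFiniteLimits C] {X A : C} (f : X ⟶ A) :
    IsKernelPair f (kernelRel f).fst (kernelRel f).snd where
  w := (mem_kernelRel f _ _).1 (kernelRel f).mem_fst_snd
  isLimit' := ⟨PullbackCone.IsLimit.mk _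
    (fun s => (((kernelRel f).mem_iff _ _).1 ((mem_kernelRel f _ _).2 s.condition)).choose)
    (fun s => (((kernelRel f).mem_iff _ _).1
      ((mem_kernelRel f _ _).2 s.condition)).choose_spec.1)
    (fun s => (((kernelRel f).mem_iff _ _).1
      ((mem_kernelRel f _ _).2 s.condition)).choose_spec.2)
    (fun s m h₁ h₂ => by
      have h := (((kernelRel f).mem_iff _ _).1 ((mem_kernelRel f _ _).2 s.condition)).choose_spec
      exact Relation.hom_ext _ (h₁.trans h.1.symm) (h₂.trans h.2.symm))⟩

variable [Regular C]

/-- The kernel pair of a regular epimorphism is an effective equivalence relation. -/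
theorem isEffectiveEquivalenceRelation_of_isKernelPair {X B R : C} {π : X ⟶ B} [IsRegularEpi π]
    {p₁ p₂ : R ⟶ X} (h : IsKernelPair π p₁ p₂) : IsEffectiveEquivalenceRelation p₁ p₂ := by
  let E := h.equivalenceRelation π p₁ p₂ (pullback.isLimit p₂ p₁)
  have po : IsPushout p₁ p₂ π π := by
    refine ⟨⟨h.w⟩, ⟨PushoutCocone.IsColimit.mk _
      (fun s => Cofork.IsColimit.desc h.toCoequalizer' s.inl ?_) (fun s => ?_) (fun s => ?_)
      (fun s m h₁ _ => ?_)⟩⟩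
    · have hs : s.inl = s.inr := by simpa [E] using congr(E.r ≫ $(s.condition))
      rw [s.condition, hs]
    · exact Cofork.IsColimit.π_desc' h.toCoequalizer' _ _
    · have hs : s.inl = s.inr := by simpa [E] using congr(E.r ≫ $(s.condition))
      exact (Cofork.IsColimit.π_desc' h.toCoequalizer' _ _).trans hs
    · rw [← cancel_epi π, h₁]
      exact (Cofork.IsColimit.π_desc' h.toCoequalizer' _ _).symm
  exact ⟨⟨{ E with B := B, π := π, isKernelPair := h, isPushout := po }⟩⟩

/-- In a regular category every kernel pair is effective: it is also the kernel pair of the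
regular epimorphism in the image factorization. -/
theorem isEffectiveEquivalenceRelation_kernelRel {X A : C} (f : X ⟶ A) :
    IsEffectiveEquivalenceRelation (kernelRel f).fst (kernelRel f).snd := by
  let F := Regular.strongEpiMonoFactorisation f
  have h : IsKernelPair (F.e ≫ F.m) (kernelRel f).fst (kernelRel f).snd := by
    rw [F.fac]
    exact isKernelPair_kernelRel f
  exact isEffectiveEquivalenceRelation_of_isKernelPair
    (IsKernelPair.cancel_right_of_mono h)

end Kernel

/-! ### Consequences of the effective Goursat property -/

section Goursat

variable {C : Type u} [Category.{v} C] [Regular C]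

theorem IsGoursat.isEffectivelyGoursat (h : IsGoursat C) : IsEffectivelyGoursat C := by
  rintro X R S ⟨⟨hR⟩⟩ ⟨⟨hS⟩⟩
  exact h R S ⟨⟨hR.toEquivalenceRelation⟩⟩ ⟨⟨hS.toEquivalenceRelation⟩⟩

/-- The effective Goursat property, for the kernel pairs of `a` and `b` and in terms of
generalized elements. -/
theorem IsEffectivelyGoursat.exists_chain (h : IsEffectivelyGoursat C) {X A B T : C} (a : X ⟶ A)
    (b : X ⟶ B) {x₁ x₂ x₃ x₄ : T ⟶ X} (h₁ : x₁ ≫ a = x₂ ≫ a) (h₂ : x₂ ≫ b = x₃ ≫ b)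
    (h₃ : x₃ ≫ a = x₄ ≫ a) :
    ∃ (T' : C) (e : T' ⟶ T) (_ : IsRegularEpi e) (y z : T' ⟶ X),
      (e ≫ x₁) ≫ b = y ≫ b ∧ y ≫ a = z ≫ a ∧ z ≫ b = (e ≫ x₄) ≫ b := by
  have H := h (kernelRel b) (kernelRel a) (isEffectiveEquivalenceRelation_kernelRel b)
    (isEffectiveEquivalenceRelation_kernelRel a)
  have hm : (((kernelRel a).comp (kernelRel b)).comp (kernelRel a)).Mem x₁ x₄ := by
    rw [Relation.mem_comp_comp_iff]
    exact ⟨T, 𝟙 T, inferInstance, x₂, x₃, by simpa [mem_kernelRel] using h₁,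
      by simpa [mem_kernelRel] using h₂, by simpa [mem_kernelRel] using h₃⟩
  rw [← H, Relation.mem_comp_comp_iff] at hm
  simpa only [mem_kernelRel] using hm

/-- Gumm's Shifting Lemma for the kernel pairs `R`, `S`, `T` of `r`, `s`, `t` with `R ∩ S ≤ T`: in a
square with horizontal sides in `R`, vertical sides in `S` and one horizontal side also in `T`, the
opposite side is in `T`. -/
theorem IsEffectivelyGoursat.shifting (h : IsEffectivelyGoursat C) {X A B D : C} (r : X ⟶ A)
    (s : X ⟶ B) (t : X ⟶ D)
    (hrs : ∀ ⦃T : C⦄ (x y : T ⟶ X), x ≫ r = y ≫ r → x ≫ s = y ≫ s → x ≫ t = y ≫ t)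
    {T : C} {x y x' y' : T ⟶ X} (hxy : x ≫ r = y ≫ r) (hx : x ≫ s = x' ≫ s) (hy : y' ≫ s = y ≫ s)
    (hxy' : x' ≫ r = y' ≫ r) (ht : x' ≫ t = y' ≫ t) : x ≫ t = y ≫ t := by
  -- `x S x' (R ∩ T) y' S y` can be rewritten as `x (R ∩ T) p S q (R ∩ T) y`, and then `p R q`.
  obtain ⟨T', e, _, p, q, h₁, h₂, h₃⟩ := h.exists_chain s (prod.lift r t) (x₁ := x) (x₂ := x')
    (x₃ := y') (x₄ := y) hx (by ext <;> simp [hxy', ht]) hy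
  have h₁r : (e ≫ x) ≫ r = p ≫ r := by simpa using congr($h₁ ≫ prod.fst)
  have h₁t : (e ≫ x) ≫ t = p ≫ t := by simpa using congr($h₁ ≫ prod.snd)
  have h₃r : q ≫ r = (e ≫ y) ≫ r := by simpa using congr($h₃ ≫ prod.fst)
  have h₃t : q ≫ t = (e ≫ y) ≫ t := by simpa using congr($h₃ ≫ prod.snd)
  have hpq : p ≫ t = q ≫ t :=
    hrs p q (by rw [← h₁r, h₃r, Category.assoc, hxy, Category.assoc]) h₂
  rw [← cancel_epi e, ← Category.assoc, h₁t, hpq, h₃t, Category.assoc]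

end Goursat

/-! ### Fibre products of points -/

section FibreProducts

variable {C : Type u} [Category.{v} C] [Regular C]

/-- In an effectively Goursat category, regular epimorphisms of points induce a regular epimorphism
between fibre products. -/
theorem IsEffectivelyGoursat.isRegularEpi_pullbackMap (h : IsEffectivelyGoursat C) {Y W : C}
    (V P : Pt Y) (V' Q : Pt W) (γ : V.X ⟶ V'.X) (α : P.X ⟶ Q.X) (β : Y ⟶ W) [IsRegularEpi γ]
    [IsRegularEpi α] (hγ : V.π ≫ β = γ ≫ V'.π) (hγσ : V.σ ≫ γ = β ≫ V'.σ)
    (hα : P.π ≫ β = α ≫ Q.π) (hασ : P.σ ≫ α = β ≫ Q.σ) :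
    IsRegularEpi (pullback.map V.π P.π V'.π Q.π γ α β hγ hα) := by
  apply isRegularEpi_of_exists_lift
  intro T t
  obtain ⟨T₁, e₁, _, v, x, hv, hx⟩ :=
    exists_lift₂_of_isRegularEpi γ α (t ≫ pullback.fst _ _) (t ≫ pullback.snd _ _)
  have hvx : (v ≫ V.π) ≫ β = (x ≫ P.π) ≫ β := by
    rw [Category.assoc, hγ, reassoc_of% hv, pullback.condition, Category.assoc, hα, reassoc_of% hx]
  -- On the fibre product, `(v, 0)` and `(0, x)` are joined by way of the base points of their
  -- fibres; exchanging the two kernel pairs yields the required lift.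
  let s (y : T₁ ⟶ Y) : T₁ ⟶ pullback V.π P.π := pullback.lift (y ≫ V.σ) (y ≫ P.σ) (by simp)
  obtain ⟨T₂, e₂, _, p, q, h₁, h₂, h₃⟩ := h.exists_chain (pullback.fst V.π P.π ≫ V.π)
    (prod.lift (pullback.fst V.π P.π ≫ γ) (pullback.snd V.π P.π ≫ α))
    (x₁ := pullback.lift v (v ≫ V.π ≫ P.σ) (by simp)) (x₂ := s (v ≫ V.π))
    (x₃ := s (x ≫ P.π)) (x₄ := pullback.lift (x ≫ P.π ≫ V.σ) x (by simp)) (by simp [s])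
    (by
      simp only [Category.assoc] at hvx
      ext <;> simp [s, hγσ, hασ, reassoc_of% hvx]) (by simp [s])
  refine ⟨T₂, e₂ ≫ e₁, isRegularEpi_comp _ _,
    pullback.lift (p ≫ pullback.fst _ _) (q ≫ pullback.snd _ _) ?_, ?_⟩
  · simpa [pullback.condition] using h₂
  · have hp := congr($h₁ ≫ prod.fst)
    have hq := congr($h₃ ≫ prod.snd)
    simp only [Category.assoc, prod.lift_fst, prod.lift_snd, pullback.lift_fst_assoc,
      pullback.lift_snd_assoc, hv, hx] at hp hq
    apply pullback.hom_ext
    · simp [← hp]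
    · simp [hq]

omit [Regular C] in
/-- A commutative square with two parallel epimorphisms is a pushout as soon as it has the existence
part of the universal property. -/
theorem isPushout_of_epi {A B D E : C} {i : A ⟶ B} {b : A ⟶ D} {l : B ⟶ E} {r : D ⟶ E}
    (w : i ≫ l = b ≫ r) [Epi b] [Epi l]
    (h : ∀ ⦃Z : C⦄ (p : B ⟶ Z) (k : D ⟶ Z), i ≫ p = b ≫ k → ∃ d : E ⟶ Z, l ≫ d = p) :
    IsPushout i b l r := by
  refine ⟨⟨w⟩, ⟨PushoutCocone.IsColimit.mk w (fun s => (h s.inl s.inr s.condition).choose)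
    (fun s => (h s.inl s.inr s.condition).choose_spec) (fun s => ?_) (fun s m h₁ _ => ?_)⟩⟩
  · rw [← cancel_epi b, ← reassoc_of% w, (h s.inl s.inr s.condition).choose_spec, s.condition]
  · rw [← cancel_epi l, h₁, (h s.inl s.inr s.condition).choose_spec]

/-- Let `q : V ⟶ V'` exhibit `V'` as the pushforward of the point `V` along `β`, and let `(α, β)` be
a regular epimorphism of points `P ⟶ Q`. In an effectively Goursat category the induced morphism
`V ×_Y P ⟶ V' ×_W Q` then exhibits its codomain as the pushforward along `α`. -/
theorem IsEffectivelyGoursat.isPushout_pullbackMap (h : IsEffectivelyGoursat C) {Y W : C}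
    (V P : Pt Y) (V' Q : Pt W) (q : V.X ⟶ V'.X) (α : P.X ⟶ Q.X) (β : Y ⟶ W) [IsRegularEpi α]
    [IsRegularEpi β] (hq : V.π ≫ β = q ≫ V'.π) (hqσ : IsPushout V.σ β q V'.σ)
    (hα : P.π ≫ β = α ≫ Q.π) (hασ : P.σ ≫ α = β ≫ Q.σ) :
    IsPushout (Pt.pullObj P.π V).σ α (pullback.map V.π P.π V'.π Q.π q α β hq hα)
      (Pt.pullObj Q.π V').σ := by
  have : IsRegularEpi q := isRegularEpi_inl_of_isPushout hqσ
  have hreg := h.isRegularEpi_pullbackMap V P V' Q q α β hq hqσ.w hα hασ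
  refine isPushout_of_epi ?_ fun Z p k w => ?_
  · apply pullback.hom_ext
    · simp [hqσ.w, reassoc_of% hα]
    · simp
  set m := pullback.map V.π P.π V'.π Q.π q α β hq hα with hm
  have hm₁ : m ≫ pullback.fst _ _ = pullback.fst _ _ ≫ q := by simp [hm]
  have hm₂ : m ≫ pullback.snd _ _ = pullback.snd _ _ ≫ α := by simp [hm]
  let a : P.X ⟶ pullback V.π P.π := (Pt.pullObj P.π V).σ
  let b : V.X ⟶ pullback V.π P.π := pullback.lift (𝟙 _) (V.π ≫ P.σ) (by simp)
  have hab : V.σ ≫ b = P.σ ≫ a := by apply pullback.hom_ext <;> simp [a, b]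
  have ha : a ≫ p = α ≫ k := w
  -- By the universal property of `V'`, the value of `p` at `(v, 0)` depends only on `q v`.
  obtain ⟨d, hd⟩ : ∃ d : V'.X ⟶ Z, q ≫ d = b ≫ p :=
    ⟨hqσ.desc (b ≫ p) (Q.σ ≫ k) (by rw [reassoc_of% hab, ha, reassoc_of% hασ]), by simp⟩
  -- Shifting along the fibres of the second projection: the case of equal first components.
  have key ⦃T : C⦄ (x y : T ⟶ pullback V.π P.π) (hxy : x ≫ m = y ≫ m)
      (hxy₁ : x ≫ pullback.fst _ _ = y ≫ pullback.fst _ _) : x ≫ p = y ≫ p := by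
    refine h.shifting (pullback.fst _ _) (pullback.snd _ _) p (fun T' x y h₁ h₂ => ?_)
      (x' := x ≫ pullback.snd _ _ ≫ a) (y' := y ≫ pullback.snd _ _ ≫ a) hxy₁ (by simp [a])
      (by simp [a]) ?_ ?_
    · rw [pullback.hom_ext h₁ h₂]
    · simp [a, ← pullback.condition_assoc, reassoc_of% hxy₁]
    · have h₂ := congr($hxy ≫ pullback.snd _ _)
      simp only [Category.assoc, hm₂] at h₂
      simp [ha, reassoc_of% h₂]
  apply (IsRegularEpi.exists_of_isKernelPair m (IsKernelPair.of_hasPullback m) p)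
  -- Shifting along the fibres of the first projection.
  have hxy := pullback.condition (f := m) (g := m)
  have h₁ := congr($hxy ≫ pullback.fst _ _)
  simp only [Category.assoc, hm₁] at h₁
  refine h.shifting m (pullback.fst _ _) p key (x' := pullback.fst m m ≫ pullback.fst _ _ ≫ b)
    (y' := pullback.snd m m ≫ pullback.fst _ _ ≫ b) hxy (by simp [b]) (by simp [b]) ?_ ?_
  · have hb : b ≫ m = q ≫ pullback.lift (𝟙 _) (V'.π ≫ Q.σ) (by simp) := by
      apply pullback.hom_ext
      · simp [hm₁, b]
      · simp [hm₂, b, hασ, reassoc_of% hq]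
    simp only [Category.assoc, hb, reassoc_of% h₁]
  · simp only [Category.assoc, ← hd, reassoc_of% h₁]

omit [Regular C] in
/-- The inverse image of a relation `R` on `X` along `f : S ⟶ X`: a (representing) pair of
morphisms into `S`, through which factor all pairs whose images under `f` are related by `R`. -/
theorem Relation.exists_inverseImage [HasFiniteLimits C] {X S : C} (R : Relation X X) (f : S ⟶ X) :
    ∃ (E : C) (t₁ t₂ : E ⟶ S), R.Mem (t₁ ≫ f) (t₂ ≫ f) ∧
      ∀ ⦃T : C⦄ (u₁ u₂ : T ⟶ S), R.Mem (u₁ ≫ f) (u₂ ≫ f) →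
        ∃ t : T ⟶ E, t ≫ t₁ = u₁ ∧ t ≫ t₂ = u₂ := by
  have c := pullback.condition (f := R.arrow) (g := prod.map f f)
  refine ⟨pullback R.arrow (prod.map f f), pullback.snd _ _ ≫ prod.fst,
    pullback.snd _ _ ≫ prod.snd, (R.mem_iff _ _).2 ⟨pullback.fst _ _, ?_, ?_⟩, fun T u₁ u₂ h => ?_⟩
  · simp [Relation.fst, reassoc_of% c]
  · simp [Relation.snd, reassoc_of% c]
  · obtain ⟨r, h₁, h₂⟩ := (R.mem_iff _ _).1 h
    have w : r ≫ R.arrow = prod.lift u₁ u₂ ≫ prod.map f f := by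
      ext
      · simpa [Relation.fst] using h₁
      · simpa [Relation.snd] using h₂
    exact ⟨pullback.lift r (prod.lift u₁ u₂) w, by simp, by simp⟩

/-- If regular epimorphisms of points induce regular epimorphisms between the kernel pairs of the
projections, then `S R S` is an equivalence relation for all equivalence relations `R` and `S`, and
therefore contains `R S R`. -/
theorem comp_comp_le_of_isRegularEpi
    (H : ∀ ⦃Y W : C⦄ (P : Pt Y) (Q : Pt W) (α : P.X ⟶ Q.X) (β : Y ⟶ W), IsRegularEpi α →
      IsRegularEpi β → ∀ w : P.π ≫ β = α ≫ Q.π, P.σ ≫ α = β ≫ Q.σ →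
        IsRegularEpi (pullback.map P.π P.π Q.π Q.π α α β w w)) {X : C} (R S : Relation X X)
    (hR : IsEquivalenceRelation R.fst R.snd) (hS : IsEquivalenceRelation S.fst S.snd) :
    (R.comp S).comp R ≤ (S.comp R).comp S := by
  set D := (S.comp R).comp S
  have hD_of_chain {T : C} {x y z w : T ⟶ X} (h₁ : S.Mem x y) (h₂ : R.Mem y z) (h₃ : S.Mem z w) :
      D.Mem x w := (Relation.mem_comp_comp_iff S R S x w).2
    ⟨T, 𝟙 T, inferInstance, y, z, by simpa using h₁, h₂, by simpa using h₃⟩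
  have hD_refl {T : C} (x : T ⟶ X) : D.Mem x x :=
    hD_of_chain (Relation.mem_refl hS x) (Relation.mem_refl hR x) (Relation.mem_refl hS x)
  -- `D` is the direct image along `S.snd` of the inverse image `E` of `R` along `S.fst`, so that
  -- `E`, as a point over `S`, maps onto `D`, as a point over `X`.
  obtain ⟨E, t₁, t₂, hE, hE_lift⟩ := R.exists_inverseImage S.fst
  obtain ⟨r, hr₁, hr₂⟩ := hE_lift (𝟙 _) (𝟙 _) (Relation.mem_refl hR _)
  obtain ⟨δ, hδ₁, hδ₂⟩ := (D.mem_iff (𝟙 X) (𝟙 X)).1 (hD_refl _)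
  obtain ⟨ρ, hρ₁, hρ₂⟩ := (S.mem_iff (𝟙 X) (𝟙 X)).1 (Relation.mem_refl hS _)
  let P : Pt (S : C) := ⟨E, t₁, r, hr₁⟩
  let Q : Pt X := ⟨(D : C), D.fst, δ, hδ₁⟩
  have hS_mem {T : C} (u : T ⟶ (S : C)) : S.Mem (u ≫ S.fst) (u ≫ S.snd) := S.mem_fst_snd.precomp u
  obtain ⟨α, hα₁, hα₂⟩ := (D.mem_iff (t₁ ≫ S.snd) (t₂ ≫ S.snd)).1
    (hD_of_chain (Relation.mem_symm hS (hS_mem t₁)) hE (hS_mem t₂))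
  have : IsRegularEpi α := isRegularEpi_of_exists_lift α fun T d => by
    obtain ⟨T', e, he, y, z, h₁, h₂, h₃⟩ := (Relation.mem_comp_comp_iff S R S _ _).1
      (D.mem_fst_snd.precomp d)
    obtain ⟨u₁, hu₁, hu₁'⟩ := (S.mem_iff _ _).1 (Relation.mem_symm hS h₁)
    obtain ⟨u₂, hu₂, hu₂'⟩ := (S.mem_iff _ _).1 h₃
    obtain ⟨x, hx₁, hx₂⟩ := hE_lift u₁ u₂ (by rwa [hu₁, hu₂])
    refine ⟨T', e, he, x, D.hom_ext ?_ ?_⟩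
    · rw [Category.assoc, hα₁, reassoc_of% hx₁, hu₁', Category.assoc]
    · rw [Category.assoc, hα₂, reassoc_of% hx₂, hu₂', Category.assoc]
  have : IsSplitEpi S.snd := ⟨⟨⟨ρ, hρ₂⟩⟩⟩
  have hreg := H P Q α S.snd inferInstance inferInstance hα₁.symm (D.hom_ext
    (by simp only [Category.assoc]; rw [hα₁, hδ₁, reassoc_of% hr₁, Category.comp_id])
    (by simp only [Category.assoc]; rw [hα₂, hδ₂, reassoc_of% hr₂, Category.comp_id]))
  have hD_eucl {T : C} {x y z : T ⟶ X} (hxy : D.Mem x y) (hxz : D.Mem x z) : D.Mem y z := by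
    obtain ⟨d, hd, hd'⟩ := (D.mem_iff _ _).1 hxy
    obtain ⟨d', hd₁, hd₁'⟩ := (D.mem_iff _ _).1 hxz
    obtain ⟨T', e, _, p, hp⟩ := exists_lift_of_isRegularEpi
      (pullback.map P.π P.π Q.π Q.π α α S.snd hα₁.symm hα₁.symm)
      (pullback.lift (f := Q.π) (g := Q.π) d d' (hd.trans hd₁.symm))
    have hp₁ := congr($hp ≫ pullback.fst _ _ ≫ D.snd)
    have hp₂ := congr($hp ≫ pullback.snd _ _ ≫ D.snd)
    simp only [Category.assoc, pullback.lift_fst_assoc, pullback.lift_snd_assoc, hα₂, hd', hd₁']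
      at hp₁ hp₂
    let u₁ : T' ⟶ E := p ≫ pullback.fst P.π P.π
    let u₂ : T' ⟶ E := p ≫ pullback.snd P.π P.π
    have hu : u₁ ≫ t₁ = u₂ ≫ t₁ := by
      simpa [u₁, u₂] using congr(p ≫ $(pullback.condition (f := P.π) (g := P.π)))
    have hR₁ : R.Mem (u₁ ≫ t₁ ≫ S.fst) (u₁ ≫ t₂ ≫ S.fst) := hE.precomp u₁
    have hR₂ : R.Mem (u₁ ≫ t₁ ≫ S.fst) (u₂ ≫ t₂ ≫ S.fst) := by
      rw [reassoc_of% hu]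
      exact hE.precomp u₂
    have hS₁ := hS_mem (u₁ ≫ t₂)
    have hS₂ := hS_mem (u₂ ≫ t₂)
    simp only [Category.assoc] at hS₁ hS₂
    refine Relation.Mem.of_cover e ?_
    rw [← hp₁, ← hp₂]
    simpa only [u₁, u₂, Category.assoc] using hD_of_chain (Relation.mem_symm hS hS₁)
      (Relation.mem_trans hR (Relation.mem_symm hR hR₁) hR₂) hS₂
  have hD_symm {T : C} {x y : T ⟶ X} (hxy : D.Mem x y) : D.Mem y x := hD_eucl hxy (hD_refl x)
  refine Relation.le_of_mem fun T x y hxy => ?_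
  obtain ⟨T', e, _, z, w, h₁, h₂, h₃⟩ := (Relation.mem_comp_comp_iff R S R x y).1 hxy
  have h₁' : D.Mem (e ≫ x) z := hD_of_chain (Relation.mem_refl hS _) h₁ (Relation.mem_refl hS _)
  have h₂' : D.Mem z w := hD_of_chain h₂ (Relation.mem_refl hR _) (Relation.mem_refl hS _)
  have h₃' : D.Mem w (e ≫ y) := hD_of_chain (Relation.mem_refl hS _) h₃ (Relation.mem_refl hS _)
  exact Relation.Mem.of_cover e (hD_eucl (hD_eucl h₁' (hD_refl _)) (hD_eucl (hD_symm h₂') h₃'))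

/-- A regular category is a Goursat category if regular epimorphisms of points induce regular
epimorphisms between the kernel pairs of the projections. -/
theorem isGoursat_of_isRegularEpi
    (H : ∀ ⦃Y W : C⦄ (P : Pt Y) (Q : Pt W) (α : P.X ⟶ Q.X) (β : Y ⟶ W), IsRegularEpi α →
      IsRegularEpi β → ∀ w : P.π ≫ β = α ≫ Q.π, P.σ ≫ α = β ≫ Q.σ →
        IsRegularEpi (pullback.map P.π P.π Q.π Q.π α α β w w)) : IsGoursat C :=
  fun _ R S hR hS => le_antisymm (comp_comp_le_of_isRegularEpi H R S hR hS)
    (comp_comp_le_of_isRegularEpi H S R hS hR)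

end FibreProducts

/-! ### The Beck–Chevalley comparison and binary products of points -/

namespace Pt

variable {C : Type u} [Category.{v} C]

theorem isIso_of_isIso_hom {Y : C} {P Q : Pt Y} (a : P ⟶ Q) [IsIso a.hom] : IsIso a :=
  ⟨⟨inv a.hom, by simp, by rw [← σ_hom a, Category.assoc, IsIso.hom_inv_id, Category.comp_id]⟩,
    hom_ext (by simp), hom_ext (by simp)⟩

theorem isIso_hom {Y : C} {P Q : Pt Y} (a : P ⟶ Q) [IsIso a] : IsIso a.hom :=
  ⟨(inv a).hom, by rw [← comp_hom, IsIso.hom_inv_id, id_hom],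
    by rw [← comp_hom, IsIso.inv_hom_id, id_hom]⟩

section Pushforward

variable [HasPushoutsAlongSplitMonos C]

/-- The canonical morphism from a point `P` over `Y` to its pushforward `β_! P`. -/
noncomputable def pushInl {Y W : C} (β : Y ⟶ W) (P : Pt Y) : P.X ⟶ (pushObj β P).X :=
  pushout.inl P.σ β

theorem isPushout_push {Y W : C} (β : Y ⟶ W) (P : Pt Y) :
    IsPushout P.σ β (pushInl β P) (pushObj β P).σ :=
  IsPushout.of_hasPushout _ _

theorem pushInl_π {Y W : C} (β : Y ⟶ W) (P : Pt Y) :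
    pushInl β P ≫ (pushObj β P).π = P.π ≫ β :=
  pushout.inl_desc _ _ _

theorem pushInl_map {Y W : C} (β : Y ⟶ W) {P Q : Pt Y} (a : P ⟶ Q) :
    pushInl β P ≫ ((push β).map a).hom = a.hom ≫ pushInl β Q :=
  pushout.inl_desc _ _ _

/-- A morphism out of a pushforward is invertible if it identifies its codomain with the pushout of
the splitting. -/
theorem isIso_of_isPushout {Y W : C} {β : Y ⟶ W} {P : Pt Y} {Q : Pt W} (a : pushObj β P ⟶ Q)
    (h : IsPushout P.σ β (pushInl β P ≫ a.hom) Q.σ) : IsIso a := by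
  have : a.hom = ((isPushout_push β P).isoIsPushout _ _ h).hom := by
    apply (isPushout_push β P).hom_ext
    · simp
    · rw [IsPushout.inr_isoIsPushout_hom]
      exact σ_hom a
  have : IsIso a.hom := by rw [this]; infer_instance
  exact isIso_of_isIso_hom a

variable [HasPullbacks C] {X Y U W : C} (f : X ⟶ Y) (β : Y ⟶ W) (α : X ⟶ U) (g : U ⟶ W)
    (w : f ≫ β = α ≫ g) (V : Pt Y)

theorem pushInl_beckChevalley_fst :
    pushInl α (pullObj f V) ≫ ((beckChevalley f β α g w).app V).hom ≫ pullback.fst _ _ =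
      pullback.fst V.π f ≫ pushInl β V := by
  simp [beckChevalley, mateEquiv, pushPullAdj, pullSquare, pushInl, pushout.inl_desc_assoc]

theorem pushInl_beckChevalley_snd :
    pushInl α (pullObj f V) ≫ ((beckChevalley f β α g w).app V).hom ≫ pullback.snd _ _ =
      pullback.snd V.π f ≫ α :=
  (congrArg _ (hom_π ((beckChevalley f β α g w).app V))).trans (pushInl_π _ _)

end Pushforward

section Product

variable [HasPullbacks C] {Y : C} (P Q : Pt Y)

/-- The product of two points over `Y`: the pullback of their projections. -/
noncomputable abbrev prodObj : Pt Y where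
  X := pullback P.π Q.π
  π := pullback.fst _ _ ≫ P.π
  σ := pullback.lift P.σ Q.σ (by simp)
  σ_π := by simp

/-- The first projection of the product of two points. -/
noncomputable def prodFst : prodObj P Q ⟶ P where
  hom := pullback.fst _ _
  w_π := rfl
  w_σ := by simp [prodObj]

/-- The second projection of the product of two points. -/
noncomputable def prodSnd : prodObj P Q ⟶ Q where
  hom := pullback.snd _ _
  w_π := pullback.condition.symm
  w_σ := by simp [prodObj]

variable {P Q}

/-- The morphism into the product of two points given by its components. -/
noncomputable def prodLift {T : Pt Y} (a : T ⟶ P) (b : T ⟶ Q) : T ⟶ prodObj P Q where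
  hom := pullback.lift a.hom b.hom (by simp)
  w_π := by simp [prodObj]
  w_σ := by apply pullback.hom_ext <;> simp [prodObj]

theorem prodLift_hom_fst {T : Pt Y} (a : T ⟶ P) (b : T ⟶ Q) :
    (prodLift a b).hom ≫ pullback.fst _ _ = a.hom := pullback.lift_fst _ _ _

theorem prodLift_hom_snd {T : Pt Y} (a : T ⟶ P) (b : T ⟶ Q) :
    (prodLift a b).hom ≫ pullback.snd _ _ = b.hom := pullback.lift_snd _ _ _

variable (P Q)

/-- `prodObj P Q` is a product of `P` and `Q` in the category of points. -/
noncomputable def prodIsLimit : IsLimit (BinaryFan.mk (prodFst P Q) (prodSnd P Q)) :=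
  BinaryFan.isLimitMk (fun s => prodLift s.fst s.snd)
    (fun _ => hom_ext (prodLift_hom_fst _ _)) (fun _ => hom_ext (prodLift_hom_snd _ _))
    (fun _ _ h₁ h₂ => hom_ext (pullback.hom_ext
      ((congrArg Hom.hom h₁).trans (prodLift_hom_fst _ _).symm)
      ((congrArg Hom.hom h₂).trans (prodLift_hom_snd _ _).symm)))

variable {P Q}

theorem isIso_prodLift_iff {T : Pt Y} (a : T ⟶ P) (b : T ⟶ Q) :
    IsIso (prodLift a b) ↔ Nonempty (IsLimit (BinaryFan.mk a b)) := by
  have h₁ : prodLift a b ≫ prodFst P Q = a := hom_ext (prodLift_hom_fst _ _)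
  have h₂ : prodLift a b ≫ prodSnd P Q = b := hom_ext (prodLift_hom_snd _ _)
  constructor
  · intro _
    exact ⟨(prodIsLimit P Q).ofIsoLimit
      (BinaryFan.ext (asIso (prodLift a b)) h₁.symm h₂.symm).symm⟩
  · rintro ⟨h⟩
    have : prodLift a b = (h.conePointUniqueUpToIso (prodIsLimit P Q)).hom := by
      apply BinaryFan.IsLimit.hom_ext (prodIsLimit P Q)
      · exact h₁.trans (h.conePointUniqueUpToIso_hom_comp (prodIsLimit P Q) ⟨.left⟩).symm
      · exact h₂.trans (h.conePointUniqueUpToIso_hom_comp (prodIsLimit P Q) ⟨.right⟩).symm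
    rw [this]
    infer_instance

/-- `β_!` preserves binary products if and only if the canonical comparison
`β_!(P × Q) ⟶ β_! P × β_! Q` is always invertible. -/
theorem preservesBinaryProducts_push_iff [HasPushoutsAlongSplitMonos C] {W : C} (β : Y ⟶ W) :
    PreservesLimitsOfShape (Discrete WalkingPair) (push β) ↔
      ∀ P Q : Pt Y, IsIso (prodLift ((push β).map (prodFst P Q)) ((push β).map (prodSnd P Q))) := by
  simp_rw [isIso_prodLift_iff]
  constructor
  · intro h P Q
    exact ⟨isLimitMapConeBinaryFanEquiv _ _ _ (isLimitOfPreserves (push β) (prodIsLimit P Q))⟩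
  · intro h
    refine ⟨fun {K} => ?_⟩
    obtain ⟨l⟩ := h (K.obj ⟨.left⟩) (K.obj ⟨.right⟩)
    have := preservesLimit_of_preserves_limit_cone (F := push β)
      (prodIsLimit (K.obj ⟨.left⟩) (K.obj ⟨.right⟩)) ((isLimitMapConeBinaryFanEquiv _ _ _).symm l)
    exact preservesLimit_of_iso_diagram _ (diagramIsoPair K).symm

end Product

end Pt

/-! ### Goursat categories, binary products and the Beck–Chevalley condition -/

section Characterization

variable {C : Type u} [Category.{v} C] [Regular C]

theorem isRegularEpi_pullbackMap_id {A A' B B' W : C} (a : A ⟶ W) (b : B ⟶ W) (a' : A' ⟶ W)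
    (b' : B' ⟶ W) (p : A ⟶ A') (q : B ⟶ B') [IsRegularEpi p] [IsRegularEpi q]
    (hp : a ≫ 𝟙 W = p ≫ a') (hq : b ≫ 𝟙 W = q ≫ b') :
    IsRegularEpi (pullback.map a b a' b' p q (𝟙 W) hp hq) := by
  apply isRegularEpi_of_exists_lift
  intro T t
  obtain ⟨T', e, he, x, y, hx, hy⟩ :=
    exists_lift₂_of_isRegularEpi p q (t ≫ pullback.fst _ _) (t ≫ pullback.snd _ _)
  rw [Category.comp_id] at hp hq
  refine ⟨T', e, he, pullback.lift x y ?_, ?_⟩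
  · rw [hp, hq, reassoc_of% hx, reassoc_of% hy, pullback.condition]
  · apply pullback.hom_ext
    · simp [hx]
    · simp [hy]

variable [HasPushoutsAlongSplitMonos C]

instance isRegularEpi_pushInl {Y W : C} (β : Y ⟶ W) [IsRegularEpi β] (P : Pt Y) :
    IsRegularEpi (Pt.pushInl β P) :=
  isRegularEpi_inl_of_isPushout (Pt.isPushout_push β P)

/-- To see that a regular epimorphism of points `P ⟶ Q` induces a regular epimorphism between the
kernel pairs of the projections, one may replace one copy of `Q` by the pushforward of `P`, and the
other by any object through which `α` factors. -/
theorem isRegularEpi_pullbackMap_of_push {Y W : C} (P : Pt Y) (Q Q' : Pt W) (α : P.X ⟶ Q.X)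
    (α' : P.X ⟶ Q'.X) (β : Y ⟶ W) [IsRegularEpi α] [IsRegularEpi β] (w : P.π ≫ β = α ≫ Q.π)
    (hσ : P.σ ≫ α = β ≫ Q.σ) (w' : P.π ≫ β = α' ≫ Q'.π) (q : Q'.X ⟶ Q.X) [IsRegularEpi q]
    (hq : α' ≫ q = α) (hq' : q ≫ Q.π = Q'.π)
    (h : IsRegularEpi (pullback.map P.π P.π (Pt.pushObj β P).π Q'.π (Pt.pushInl β P) α' β
      (Pt.pushInl_π β P).symm w')) :
    IsRegularEpi (pullback.map P.π P.π Q.π Q.π α α β w w) := by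
  let a : (Pt.pushObj β P).X ⟶ Q.X := (Pt.isPushout_push β P).desc α Q.σ hσ
  have ha : Pt.pushInl β P ≫ a = α := IsPushout.inl_desc _ _ _ _
  have haπ : a ≫ Q.π = (Pt.pushObj β P).π := by
    rw [← cancel_epi (Pt.pushInl β P), reassoc_of% ha, Pt.pushInl_π, w]
  have : IsRegularEpi (Pt.pushInl β P ≫ a) := by rwa [ha]
  have : IsRegularEpi a := isRegularEpi_of_comp (Pt.pushInl β P) a
  have := isRegularEpi_pullbackMap_id (Pt.pushObj β P).π Q'.π Q.π Q.π a q
    (by rw [haπ, Category.comp_id]) (by rw [hq', Category.comp_id])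
  have e : pullback.map P.π P.π Q.π Q.π α α β w w =
      pullback.map P.π P.π (Pt.pushObj β P).π Q'.π (Pt.pushInl β P) α' β
        (Pt.pushInl_π β P).symm w' ≫ pullback.map (Pt.pushObj β P).π Q'.π Q.π Q.π a q (𝟙 W)
          (by rw [haπ, Category.comp_id]) (by rw [hq', Category.comp_id]) := by
    apply pullback.hom_ext
    · simp [ha]
    · simp [hq]
  rw [e]
  exact isRegularEpi_comp _ _

theorem pushInl_beckChevalley {Y W : C} (P : Pt Y) (Q : Pt W) (α : P.X ⟶ Q.X) (β : Y ⟶ W)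
    (w : P.π ≫ β = α ≫ Q.π) (V : Pt Y) :
    Pt.pushInl α (Pt.pullObj P.π V) ≫ ((Pt.beckChevalley P.π β α Q.π w).app V).hom =
      pullback.map V.π P.π (Pt.pushObj β V).π Q.π (Pt.pushInl β V) α β (Pt.pushInl_π β V).symm w := by
  apply pullback.hom_ext
  · rw [Category.assoc]
    exact (Pt.pushInl_beckChevalley_fst P.π β α Q.π w V).trans (pullback.lift_fst _ _ _).symm
  · rw [Category.assoc]
    exact (Pt.pushInl_beckChevalley_snd P.π β α Q.π w V).trans (pullback.lift_snd _ _ _).symm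

theorem IsEffectivelyGoursat.isIso_beckChevalley (h : IsEffectivelyGoursat C) {Y W : C} (P : Pt Y)
    (Q : Pt W) (α : P.X ⟶ Q.X) (β : Y ⟶ W) [IsRegularEpi α] [IsRegularEpi β]
    (w : P.π ≫ β = α ≫ Q.π) (hσ : P.σ ≫ α = β ≫ Q.σ) :
    IsIso (Pt.beckChevalley P.π β α Q.π w) := by
  have (V : Pt Y) : IsIso ((Pt.beckChevalley P.π β α Q.π w).app V) := by
    apply Pt.isIso_of_isPushout
    rw [pushInl_beckChevalley P Q α β w V]
    exact h.isPushout_pullbackMap V P (Pt.pushObj β V) Q (Pt.pushInl β V) α β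
      (Pt.pushInl_π β V).symm (Pt.isPushout_push β V) w hσ
  exact NatIso.isIso_of_isIso_app _

theorem pushInl_prodLift {Y W : C} (β : Y ⟶ W) (P Q : Pt Y) :
    Pt.pushInl β (Pt.prodObj P Q) ≫ (Pt.prodLift ((Pt.push β).map (Pt.prodFst P Q))
      ((Pt.push β).map (Pt.prodSnd P Q))).hom =
    pullback.map P.π Q.π (Pt.pushObj β P).π (Pt.pushObj β Q).π (Pt.pushInl β P) (Pt.pushInl β Q) β
      (Pt.pushInl_π β P).symm (Pt.pushInl_π β Q).symm := by
  apply pullback.hom_ext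
  · rw [Category.assoc, Pt.prodLift_hom_fst, Pt.pushInl_map]
    simp [Pt.prodFst]
  · rw [Category.assoc, Pt.prodLift_hom_snd, Pt.pushInl_map]
    simp [Pt.prodSnd]

theorem IsEffectivelyGoursat.preservesBinaryProducts_push (h : IsEffectivelyGoursat C) {Y W : C}
    (β : Y ⟶ W) [IsRegularEpi β] :
    PreservesLimitsOfShape (Discrete WalkingPair) (Pt.push β) := by
  rw [Pt.preservesBinaryProducts_push_iff]
  intro P Q
  apply Pt.isIso_of_isPushout
  rw [pushInl_prodLift]
  -- The splitting of the product factors through `Q`, so the square is a pasting of two pushouts.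
  have := (Pt.isPushout_push β Q).paste_horiz (h.isPushout_pullbackMap P Q (Pt.pushObj β P)
    (Pt.pushObj β Q) (Pt.pushInl β P) (Pt.pushInl β Q) β (Pt.pushInl_π β P).symm
    (Pt.isPushout_push β P) (Pt.pushInl_π β Q).symm (Pt.isPushout_push β Q).w)
  convert this using 1 <;> apply pullback.hom_ext <;> simp [pushout.inr_desc_assoc]

theorem isGoursat_of_preservesBinaryProducts_push
    (h : ∀ ⦃Y W : C⦄ (β : Y ⟶ W), IsRegularEpi β →
      PreservesLimitsOfShape (Discrete WalkingPair) (Pt.push β)) : IsGoursat C := by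
  refine isGoursat_of_isRegularEpi fun Y W P Q α β _ _ w hσ => ?_
  have := (Pt.preservesBinaryProducts_push_iff β).1 (h β inferInstance) P P
  have := Pt.isIso_hom (Pt.prodLift ((Pt.push β).map (Pt.prodFst P P))
    ((Pt.push β).map (Pt.prodSnd P P)))
  let a : (Pt.pushObj β P).X ⟶ Q.X := (Pt.isPushout_push β P).desc α Q.σ hσ
  have ha : Pt.pushInl β P ≫ a = α := IsPushout.inl_desc _ _ _ _
  have : IsRegularEpi (Pt.pushInl β P ≫ a) := by rwa [ha]
  have : IsRegularEpi a := isRegularEpi_of_comp (Pt.pushInl β P) a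
  refine isRegularEpi_pullbackMap_of_push P Q (Pt.pushObj β P) α (Pt.pushInl β P) β w hσ
    (Pt.pushInl_π β P).symm a ha ?_ ?_
  · rw [← cancel_epi (Pt.pushInl β P), reassoc_of% ha, Pt.pushInl_π, w]
  · rw [← pushInl_prodLift]
    have := isRegularEpi_pushInl β (Pt.prodObj P P)
    exact isRegularEpi_comp _ _

theorem isGoursat_of_isIso_beckChevalley
    (h : ∀ ⦃Y W : C⦄ (P : Pt Y) (Q : Pt W) (α : P.X ⟶ Q.X) (β : Y ⟶ W), IsRegularEpi α →
      IsRegularEpi β → ∀ w : P.π ≫ β = α ≫ Q.π, P.σ ≫ α = β ≫ Q.σ →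
        IsIso (Pt.beckChevalley P.π β α Q.π w)) : IsGoursat C := by
  refine isGoursat_of_isRegularEpi fun Y W P Q α β _ _ w hσ => ?_
  have := h P Q α β inferInstance inferInstance w hσ
  have := Pt.isIso_hom ((Pt.beckChevalley P.π β α Q.π w).app P)
  refine isRegularEpi_pullbackMap_of_push P Q Q α α β w hσ w (𝟙 _) (Category.comp_id _)
    (Category.id_comp _) ?_
  rw [← pushInl_beckChevalley]
  have := isRegularEpi_pushInl α (Pt.pullObj P.π P)
  exact isRegularEpi_comp _ _

end Characterization

/-! ### Non-canonical Beck–Chevalley isomorphisms -/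

section NonCanonical

variable {C : Type u} [Category.{v} C]

/-- The projection from the pullback of a point along an identity. -/
noncomputable def Pt.pullIdHom [HasPullbacks C] {Y : C} (P : Pt Y) : Pt.pullObj (𝟙 Y) P ⟶ P where
  hom := pullback.fst _ _
  w_π := by rw [pullback.condition, Category.comp_id]
  w_σ := by simp

/-- Pullback along an identity is isomorphic to the identity functor. -/
noncomputable def Pt.pullId [HasPullbacks C] (Y : C) : Pt.pull (𝟙 Y) ≅ 𝟭 (Pt Y) :=
  NatIso.ofComponents
    (fun P =>
      have : IsIso (Pt.pullIdHom P).hom := inferInstanceAs (IsIso (pullback.fst P.π (𝟙 Y)))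
      have := Pt.isIso_of_isIso_hom (Pt.pullIdHom P)
      @asIso _ _ _ _ (Pt.pullIdHom P) this)
    (fun a => Pt.hom_ext (by simp [Pt.pullIdHom]))

/-- Pushforward along an identity is isomorphic to the identity functor. -/
noncomputable def Pt.pushId [HasPullbacks C] [HasPushoutsAlongSplitMonos C] (Y : C) :
    Pt.push (𝟙 Y) ≅ 𝟭 (Pt Y) :=
  ((Pt.pushPullAdj (𝟙 Y)).ofNatIsoRight (Pt.pullId Y)).leftAdjointUniq Adjunction.id

variable [Regular C] [HasPushoutsAlongSplitMonos C]

/-- If all Beck–Chevalley squares commute up to some isomorphism, then the pullback functor along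
any split epimorphism is full. -/
theorem full_pull_of_nonempty_iso
    (h : ∀ ⦃Y W : C⦄ (P : Pt Y) (Q : Pt W) (α : P.X ⟶ Q.X) (β : Y ⟶ W),
      IsRegularEpi α → IsRegularEpi β → P.π ≫ β = α ≫ Q.π → P.σ ≫ α = β ≫ Q.σ →
        Nonempty (Pt.pull P.π ⋙ Pt.push α ≅ Pt.push β ⋙ Pt.pull Q.π)) {Y : C} (P : Pt Y) :
    (Pt.pull P.π).Full := by
  have : IsSplitEpi P.π := ⟨⟨⟨P.σ, P.σ_π⟩⟩⟩
  -- The square with lower edge the identity of `Y` gives `P.π_! P.π^* ≅ 1`; the counit of the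
  -- adjunction is then invertible, although it need not be this isomorphism.
  obtain ⟨φ⟩ := h P ⟨Y, 𝟙 Y, 𝟙 Y, by simp⟩ P.π (𝟙 Y) inferInstance inferInstance (by simp) (by simp)
  have := (Pt.pushPullAdj P.π).isIso_counit_of_iso
    (φ ≪≫ Functor.isoWhiskerRight (Pt.pushId Y) _ ≪≫ Functor.leftUnitor _ ≪≫ Pt.pullId Y)
  exact (Pt.pushPullAdj P.π).fullyFaithfulROfIsIsoCounit.full

/-- If all Beck–Chevalley squares commute up to some isomorphism, then the canonical comparison
is invertible. -/
theorem isIso_beckChevalley_of_nonempty_iso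
    (h : ∀ ⦃Y W : C⦄ (P : Pt Y) (Q : Pt W) (α : P.X ⟶ Q.X) (β : Y ⟶ W),
      IsRegularEpi α → IsRegularEpi β → P.π ≫ β = α ≫ Q.π → P.σ ≫ α = β ≫ Q.σ →
        Nonempty (Pt.pull P.π ⋙ Pt.push α ≅ Pt.push β ⋙ Pt.pull Q.π))
    {Y W : C} (P : Pt Y) (Q : Pt W) (α : P.X ⟶ Q.X) (β : Y ⟶ W) [IsRegularEpi α] [IsRegularEpi β]
    (w : P.π ≫ β = α ≫ Q.π) (hσ : P.σ ≫ α = β ≫ Q.σ) :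
    IsIso (Pt.beckChevalley P.π β α Q.π w) := by
  obtain ⟨φ⟩ := h P Q α β inferInstance inferInstance w hσ
  have := full_pull_of_nonempty_iso h P
  suffices ∀ V : Pt Y, IsIso ((Pt.beckChevalley P.π β α Q.π w).app V) from
    NatIso.isIso_of_isIso_app _
  intro V
  let V' := Pt.pushObj β V
  let E : Pt Q.X := Pt.pushObj α (Pt.pullObj P.π V)
  let ι : pullback V.π P.π ⟶ E.X := Pt.pushInl α (Pt.pullObj P.π V)
  have : IsRegularEpi ι := isRegularEpi_pushInl α (Pt.pullObj P.π V)
  let a : E ⟶ Pt.pullObj Q.π V' := φ.hom.app V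
  let b : E ⟶ Pt.pullObj Q.π V' := (Pt.beckChevalley P.π β α Q.π w).app V
  have : IsIso a := inferInstanceAs (IsIso (φ.hom.app V))
  have := Pt.isIso_hom a
  have hι : ι ≫ E.π = pullback.snd _ _ ≫ α := Pt.pushInl_π α (Pt.pullObj P.π V)
  have hισ : (Pt.pullObj P.π V).σ ≫ ι = α ≫ E.σ := (Pt.isPushout_push α (Pt.pullObj P.π V)).w
  have haπ : a.hom ≫ pullback.snd _ _ = E.π := Pt.hom_π a
  have hbπ : b.hom ≫ pullback.snd _ _ = E.π := Pt.hom_π b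
  have haσ : E.σ ≫ a.hom = (Pt.pullObj Q.π V').σ := Pt.σ_hom a
  have hb : ι ≫ b.hom ≫ pullback.fst _ _ = pullback.fst _ _ ≫ Pt.pushInl β V :=
    Pt.pushInl_beckChevalley_fst P.π β α Q.π w V
  -- The first component of `a` on elements `(v, x)` is a morphism of points over `P.X`, so by
  -- fullness it does not depend on `x`.
  obtain ⟨c, hc⟩ : ∃ c : V ⟶ Pt.pullObj β V', ι ≫ a.hom ≫ pullback.fst _ _ =
      pullback.fst V.π P.π ≫ c.hom ≫ pullback.fst V'.π β := by
    have h₁ : (ι ≫ a.hom ≫ pullback.fst _ _) ≫ V'.π = (pullback.snd V.π P.π ≫ P.π) ≫ β := by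
      simp only [Category.assoc]
      rw [pullback.condition, reassoc_of% haπ, reassoc_of% hι, w]
    have h₂ : (Pt.pullObj P.π V).σ ≫ ι ≫ a.hom ≫ pullback.fst _ _ = P.π ≫ β ≫ V'.σ := by
      rw [reassoc_of% hισ, reassoc_of% haσ]
      simp [reassoc_of% w]
    let c' : (Pt.pull P.π).obj V ⟶ (Pt.pull P.π).obj (Pt.pullObj β V') :=
      { hom := pullback.lift (pullback.lift _ _ h₁) (pullback.snd V.π P.π) (by simp)
        w_π := by simp
        w_σ := by
          apply pullback.hom_ext
          · apply pullback.hom_ext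
            · simpa using h₂
            · simp
          · simp }
    obtain ⟨c, hc⟩ := (Pt.pull P.π).map_surjective c'
    refine ⟨c, ?_⟩
    have := congr(Pt.Hom.hom $hc ≫ pullback.fst _ _ ≫ pullback.fst _ _)
    simpa [c'] using this.symm
  -- Thus `a` is the canonical comparison `b` followed by an endomorphism `t` of `β_! V`.
  let t : V' ⟶ V' := ((Pt.pushPullAdj β).homEquiv V V').symm c
  have ht : Pt.pushInl β V ≫ t.hom = c.hom ≫ pullback.fst _ _ := by
    simp [t, Pt.pushPullAdj, Pt.pushInl, pushout.inl_desc]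
  have hab : a.hom ≫ pullback.fst _ _ = b.hom ≫ pullback.fst _ _ ≫ t.hom := by
    rw [← cancel_epi ι, hc, reassoc_of% hb, ht]
  have hab' : a = b ≫ (Pt.pull Q.π).map t := by
    apply Pt.hom_ext
    apply pullback.hom_ext
    · simpa using hab
    · simp [haπ, hbπ]
  -- The map `d` sends `v` to the class of `(v, 0)`; it is a section of the first component of `b`.
  obtain ⟨d, hd, hdσ⟩ : ∃ d : V'.X ⟶ E.X,
      Pt.pushInl β V ≫ d = pullback.lift (𝟙 _) (V.π ≫ P.σ) (by simp) ≫ ι ∧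
      V'.σ ≫ d = Q.σ ≫ E.σ := by
    refine ⟨(Pt.isPushout_push β V).desc _ (Q.σ ≫ E.σ) ?_, IsPushout.inl_desc _ _ _ _,
      IsPushout.inr_desc _ _ _ _⟩
    have : V.σ ≫ pullback.lift (𝟙 _) (V.π ≫ P.σ) (by simp) = P.σ ≫ (Pt.pullObj P.π V).σ := by
      apply pullback.hom_ext <;> simp
    rw [← reassoc_of% hσ, ← hισ, reassoc_of% this]
  have hdb : d ≫ b.hom ≫ pullback.fst _ _ = 𝟙 _ := by
    rw [← cancel_epi (Pt.pushInl β V), reassoc_of% hd, hb]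
    simp [V']
  have hdπ : d ≫ E.π = V'.π ≫ Q.σ := by
    rw [← cancel_epi (Pt.pushInl β V), reassoc_of% hd, hι]
    simp [V', reassoc_of% Pt.pushInl_π β V, hσ]
  -- Invertibility of `a`, restricted to the fibre over `Q.σ`, makes `t` invertible.
  have : IsIso t.hom := by
    have : Mono t.hom := ⟨fun {T} x y hxy => by
      have hπ : x ≫ V'.π = y ≫ V'.π := by
        rw [← Pt.hom_π t, reassoc_of% hxy]
      have h₁ : x ≫ d ≫ a.hom = y ≫ d ≫ a.hom := by
        apply pullback.hom_ext
        · simp only [Category.assoc]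
          rw [hab, reassoc_of% hdb, hxy]
        · simp only [Category.assoc]
          rw [haπ, hdπ, reassoc_of% hπ]
      have h₂ : x ≫ d = y ≫ d := by
        rwa [← Category.assoc, ← Category.assoc, cancel_mono] at h₁
      simpa [hdb] using congr($h₂ ≫ b.hom ≫ pullback.fst _ _)⟩
    have : IsSplitEpi t.hom := ⟨⟨⟨pullback.lift (𝟙 _) (V'.π ≫ Q.σ) (by simp) ≫ inv a.hom ≫
      b.hom ≫ pullback.fst _ _, by
        simp only [Category.assoc]
        rw [← hab]
        simp⟩⟩⟩
    exact isIso_of_mono_of_isSplitEpi _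
  have := Pt.isIso_of_isIso_hom t
  have : IsIso (b ≫ (Pt.pull Q.π).map t) := by rwa [← hab']
  have : IsIso ((Pt.pull Q.π).map t) := Functor.map_isIso _ t
  exact IsIso.of_isIso_comp_right b ((Pt.pull Q.π).map t)

end NonCanonical

end GoursatPt

/-- Characterisation of Goursat categories among regular categories with pushouts along split
monomorphisms. The first two items are the Goursat property, for all and for effective equivalence
relations; the third is preservation of binary products by `β_!`; the last two are the
Beck–Chevalley condition: existence of a natural isomorphism `α_! f^* ≅ g^* β_!`, and
invertibility of the canonical comparison. In these, `P = (X, f, i)` and `Q = (U, g, j)` are points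
over `Y` and `W`, and `(α, β)` is a morphism of points from `P` to `Q`. -/
theorem theorem1p4 (C : Type u) [Category.{v} C] [Regular C]
    [GoursatPt.HasPushoutsAlongSplitMonos C] :
    List.TFAE [
      GoursatPt.IsGoursat C,
      GoursatPt.IsEffectivelyGoursat C,
      ∀ ⦃Y W : C⦄ (β : Y ⟶ W), IsRegularEpi β →
        PreservesLimitsOfShape (Discrete WalkingPair) (GoursatPt.Pt.push β),
      ∀ ⦃Y W : C⦄ (P : GoursatPt.Pt Y) (Q : GoursatPt.Pt W) (α : P.X ⟶ Q.X) (β : Y ⟶ W),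
        IsRegularEpi α → IsRegularEpi β → P.π ≫ β = α ≫ Q.π → P.σ ≫ α = β ≫ Q.σ →
          Nonempty (GoursatPt.Pt.pull P.π ⋙ GoursatPt.Pt.push α ≅
            GoursatPt.Pt.push β ⋙ GoursatPt.Pt.pull Q.π),
      ∀ ⦃Y W : C⦄ (P : GoursatPt.Pt Y) (Q : GoursatPt.Pt W) (α : P.X ⟶ Q.X) (β : Y ⟶ W),
        IsRegularEpi α → IsRegularEpi β → ∀ w : P.π ≫ β = α ≫ Q.π, P.σ ≫ α = β ≫ Q.σ →
          IsIso (GoursatPt.Pt.beckChevalley P.π β α Q.π w)] := by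
  tfae_have 1 → 2 := GoursatPt.IsGoursat.isEffectivelyGoursat
  tfae_have 2 → 3 := fun h _ _ β _ => h.preservesBinaryProducts_push β
  tfae_have 3 → 1 := GoursatPt.isGoursat_of_preservesBinaryProducts_push
  tfae_have 2 → 5 := fun h _ _ P Q α β _ _ w hσ => h.isIso_beckChevalley P Q α β w hσ
  tfae_have 5 → 1 := GoursatPt.isGoursat_of_isIso_beckChevalley
  tfae_have 5 → 4 := fun h _ _ P Q α β hα hβ w hσ =>
    have := h P Q α β hα hβ w hσ
    ⟨asIso (GoursatPt.Pt.beckChevalley P.π β α Q.π w)⟩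
  tfae_have 4 → 5 := fun h _ _ P Q α β _ _ w hσ =>
    GoursatPt.isIso_beckChevalley_of_nonempty_iso h P Q α β w hσ
  tfae_finish
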